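/- Let $X$ be a real Banach space with $\dim X\ge 2$. For unit vectors $x,y\in X$ call $y$ quasiorthogonal to $x$, written $y\urcorner x$, if there is $p\in X^*$ with $\|p\|=1$, $p(x)=1$ and $p(y)=0$. For unit vectors $x,y$ with $y\urcorner x$ and $r\in[0,1]$ put $$\lambda_X(x,y,r)=\min\{\lambda\in\mathbb{R}:\ \|x+ry-\lambda x\|=1\},$$ $$\lambda_X^-(x,y,r)=\min\{\lambda_X(x,y,r),\lambda_X(x,-y,r)\},\qquad \lambda_X^+(x,y,r)=\max\{\lambda_X(x,y,r),\lambda_X(x,-y,r)\}.$$ Define the moduli of supporting convexity and of supporting smoothness, for $r\in[0,1]$, by $$\lambda_X^-(r)=\inf_{\|x\|=1}\lambda^-_X(x,r),\qquad \lambda_X^-(x,r)=\inf\{\lambda_X^-(x,y,r):\ \|y\|=1,\ y\urcorner x\},$$ $$\lambda_X^+(r)=\sup_{\|x\|=1,\ 0\le t\le r}\lambda_X^+(x,t),\qquad \lambda_X^+(x,r)=\sup\{\lambda_X^+(x,y,t):\ \|y\|=1,\ y\urcorner x,\ 0\le t\le r\}.$$ Then for every real Hilbert space $H$ with $\dim H\ge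 2$ and every $r\in[0,1]$, $$\lambda_X^-(r)\le\lambda_H^-(r)=1-\sqrt{1-r^2}=\lambda_H^+(r)\le\lambda_X^+(r).$$ Moreover, if $\lambda_X^-(r)=1-\sqrt{1-r^2}$ for all $r\in[0,1]$, or if $\lambda_X^+(r)=1-\sqrt{1-r^2}$ for all $r\in[0,1]$, then $X$ is a Hilbert space, i.e. its norm is induced by an inner product. -/

import Mathlib

/-- `y` is quasiorthogonal to `x`: some norm-one functional `p` with `p x = ‖x‖` vanishes at `y`. -/
def QuasiOrthogonal {X : Type*} [NormedAddCommGroup X] [NormedSpace ℝ X] (y x : X) : Prop :=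
  ∃ p : StrongDual ℝ X, ‖p‖ = 1 ∧ p x = ‖x‖ ∧ p y = 0

/-- `λ_X(x, y, r) = min {λ ∈ ℝ : ‖x + r y - λ x‖ = 1}`.  When `x, y` are unit vectors, `y` is
quasiorthogonal to `x` and `0 ≤ r ≤ 1`, this set is nonempty, closed and contained in `[0, ∞)`
(see `isLeast_supportingDepth`), so that the infimum is a minimum. -/
noncomputable def supportingDepth {X : Type*} [NormedAddCommGroup X] [NormedSpace ℝ X]
    (x y : X) (r : ℝ) : ℝ :=
  sInf {l : ℝ | ‖x + r • y - l • x‖ = 1}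

theorem isLeast_supportingDepth {X : Type*} [NormedAddCommGroup X] [NormedSpace ℝ X]
    {x y : X} {r : ℝ} (hx : ‖x‖ = 1) (hy : ‖y‖ = 1) (hyx : QuasiOrthogonal y x)
    (h0 : 0 ≤ r) (h1 : r ≤ 1) :
    IsLeast {l : ℝ | ‖x + r • y - l • x‖ = 1} (supportingDepth x y r) ∧
      0 ≤ supportingDepth x y r ∧ supportingDepth x y r ≤ 1 := by
  obtain ⟨p, hp, hpx, hpy⟩ := hyx
  have hc : Continuous fun l : ℝ => ‖x + r • y - l • x‖ := by fun_prop
  have hlow : ∀ l : ℝ, 1 - l ≤ ‖x + r • y - l • x‖ := fun l => by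
    have h := (le_abs_self _).trans (p.le_opNorm (x + r • y - l • x))
    simpa [hp, hpx, hpy, hx] using h
  have hb : ∀ l ∈ {l : ℝ | ‖x + r • y - l • x‖ = 1}, 0 ≤ l := fun l hl => by
    have h := hlow l
    have hl : ‖x + r • y - l • x‖ = 1 := hl
    linarith
  have hiv := intermediate_value_Icc' (zero_le_one' ℝ) hc.continuousOn
  have hmem : (1 : ℝ) ∈ Set.Icc ‖x + r • y - (1 : ℝ) • x‖ ‖x + r • y - (0 : ℝ) • x‖ := by
    constructor
    · simpa [norm_smul, hy, abs_of_nonneg h0] using h1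
    · simpa using hlow 0
  obtain ⟨l, hl, hl1⟩ := hiv hmem
  have hbdd : BddBelow {l : ℝ | ‖x + r • y - l • x‖ = 1} := ⟨0, hb⟩
  have hcl : IsClosed {l : ℝ | ‖x + r • y - l • x‖ = 1} := isClosed_eq hc continuous_const
  have hm := hcl.csInf_mem ⟨l, hl1⟩ hbdd
  exact ⟨⟨hm, fun a ha => csInf_le hbdd ha⟩, hb _ hm, (csInf_le hbdd hl1).trans hl.2⟩

/-- `λ⁻_X(x, y, r)`. -/
noncomputable def supportingDepthMin {X : Type*} [NormedAddCommGroup X] [NormedSpace ℝ X]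
    (x y : X) (r : ℝ) : ℝ :=
  min (supportingDepth x y r) (supportingDepth x (-y) r)

/-- `λ⁺_X(x, y, r)`. -/
noncomputable def supportingDepthMax {X : Type*} [NormedAddCommGroup X] [NormedSpace ℝ X]
    (x y : X) (r : ℝ) : ℝ :=
  max (supportingDepth x y r) (supportingDepth x (-y) r)

/-- The modulus of local supporting convexity `λ⁻_X(x, r)`, the infimum of `λ⁻_X(x, y, r)` over the
unit vectors `y` quasiorthogonal to `x`. -/
noncomputable def localSupportingConvexity {X : Type*} [NormedAddCommGroup X] [NormedSpace ℝ X]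
    (x : X) (r : ℝ) : ℝ :=
  sInf {a : ℝ | ∃ y : X, ‖y‖ = 1 ∧ QuasiOrthogonal y x ∧ a = supportingDepthMin x y r}

/-- The modulus of local supporting smoothness `λ⁺_X(x, r)`, the supremum of `λ⁺_X(x, y, t)` over
the unit vectors `y` quasiorthogonal to `x` and `0 ≤ t ≤ r`. -/
noncomputable def localSupportingSmoothness {X : Type*} [NormedAddCommGroup X] [NormedSpace ℝ X]
    (x : X) (r : ℝ) : ℝ :=
  sSup {a : ℝ | ∃ (y : X) (t : ℝ), ‖y‖ = 1 ∧ QuasiOrthogonal y x ∧ 0 ≤ t ∧ t ≤ r ∧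
    a = supportingDepthMax x y t}

/-- The modulus of supporting convexity `λ⁻_X(r)`. -/
noncomputable def supportingConvexity (X : Type*) [NormedAddCommGroup X] [NormedSpace ℝ X]
    (r : ℝ) : ℝ :=
  sInf {a : ℝ | ∃ x : X, ‖x‖ = 1 ∧ a = localSupportingConvexity x r}

/-- The modulus of supporting smoothness `λ⁺_X(r)`. -/
noncomputable def supportingSmoothness (X : Type*) [NormedAddCommGroup X] [NormedSpace ℝ X]
    (r : ℝ) : ℝ :=
  sSup {a : ℝ | ∃ (x : X) (t : ℝ), ‖x‖ = 1 ∧ 0 ≤ t ∧ t ≤ r ∧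
    a = localSupportingSmoothness x t}

/-- `X` is a Hilbert space: it is complete and its given norm and scalar multiplication are those of
some inner product. -/
def IsHilbertSpace (X : Type*) [NormedAddCommGroup X] [h : NormedSpace ℝ X] : Prop :=
  CompleteSpace X ∧ ∃ I : InnerProductSpace ℝ X, I.toNormedSpace = h

/-! ### Depths: bounds and passage to the moduli -/

section Depth

variable {X : Type*} [NormedAddCommGroup X] [NormedSpace ℝ X] {x y : X} {r a : ℝ}

/-! The Hilbert values are a direct computation. Both comparison inequalities reduce to a plane,
since quasiorthogonality in a subspace extends to `X` by Hahn–Banach, and there both are area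
arguments. Write `c = √(1 - r²)`.

Convexity: if every tangent segment of length `r` at a point of `c` times the unit sphere ended
outside the unit ball `B`, then `cB` and the tangent segments of length at most `r` would cover `B`.
Translated to a common origin, these segments fill at most `rB`, so the covering area is at most
`(c² + r²) area B = area B`. This is only borderline, so `exists_norm_add_le_of_finset` works with
polygons and a slack `δ`, and compactness (`exists_quasiOrthogonal_norm_add_le`) removes both.

Smoothness: choose `x, y` in the unit ball spanning maximal area. Each is quasiorthogonal to the
other up to sign, and rotating the pair preserves the area, so `c x + r y` and `c y - r x` cannot
both lie in the open ball; hence one of the two depths is at least `1 - c`.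

Rigidity: equality of a modulus makes the unit ball lie inside (convexity) or contain (smoothness)
the ellipse of every quasiorthogonal pair. Comparing the ellipses of two pairs in one plane forces
the ball to equal the ellipse. The norm is then Euclidean on all such pairs, and Jordan–von Neumann
applies. -/

theorem QuasiOrthogonal.neg_left (h : QuasiOrthogonal y x) : QuasiOrthogonal (-y) x := by
  obtain ⟨p, hp, hpx, hpy⟩ := h
  exact ⟨p, hp, hpx, by simp [hpy]⟩

/-- A nonzero functional attaining its maximum over the unit ball at `x` exhibits every vector of
its kernel as quasiorthogonal to `x`. -/
theorem quasiOrthogonal_of_forall_le {f : StrongDual ℝ X} (hf : f ≠ 0) (hx : ‖x‖ ≤ 1)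
    (h : ∀ z, ‖z‖ ≤ 1 → f z ≤ f x) (hy : f y = 0) : ‖x‖ = 1 ∧ QuasiOrthogonal y x := by
  have hf0 : 0 < ‖f‖ := norm_pos_iff.2 hf
  have h0 : 0 ≤ f x := by simpa using h 0 (by simp)
  have h1 : ‖f‖ ≤ f x := by
    refine ContinuousLinearMap.opNorm_le_of_unit_norm h0 fun z hz => ?_
    rw [Real.norm_eq_abs, abs_le]
    have := h (-z) (by simp [hz])
    rw [map_neg] at this
    exact ⟨by linarith, h z hz.le⟩
  have h2 : f x ≤ ‖f‖ * ‖x‖ := (le_abs_self _).trans (f.le_opNorm x)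
  have h3 : ‖x‖ = 1 := by
    refine le_antisymm hx ?_
    by_contra! h4
    nlinarith
  have h4 : f x = ‖f‖ := by
    rw [h3, mul_one] at h2
    exact le_antisymm h2 h1
  refine ⟨h3, ‖f‖⁻¹ • f, ?_, ?_, ?_⟩
  · rw [norm_smul, norm_inv, norm_norm, inv_mul_cancel₀ hf0.ne']
  · simp [h4, h3, hf0.ne']
  · simp [hy]

theorem QuasiOrthogonal.coe {S : Submodule ℝ X} {x y : S} (h : QuasiOrthogonal y x) :
    QuasiOrthogonal (y : X) (x : X) := by
  obtain ⟨p, hp, hpx, hpy⟩ := h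
  obtain ⟨g, hg, hgn⟩ := exists_extension_norm_eq S p
  exact ⟨g, hgn.trans hp, by rw [hg, hpx]; rfl, by rw [hg, hpy]⟩

theorem norm_supportingDepth (hx : ‖x‖ = 1) (hy : ‖y‖ = 1) (hyx : QuasiOrthogonal y x)
    (h0 : 0 ≤ r) (h1 : r ≤ 1) : ‖(1 - supportingDepth x y r) • x + r • y‖ = 1 := by
  have h := (isLeast_supportingDepth hx hy hyx h0 h1).1.1
  rw [Set.mem_ofPred_eq] at h
  convert h using 2
  module

/-- The norm along `l ↦ x + r y - l x` is at least 1 at `l = 0`, by the supporting functional, and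
at most 1 at `l = 1 - a`, so it equals 1 in between. -/
theorem supportingDepth_le_of_norm_le (hx : ‖x‖ = 1) (hy : ‖y‖ = 1) (hyx : QuasiOrthogonal y x)
    (h0 : 0 ≤ r) (h1 : r ≤ 1) (ha : a ≤ 1) (h : ‖a • x + r • y‖ ≤ 1) :
    supportingDepth x y r ≤ 1 - a := by
  have hc : Continuous fun l : ℝ => ‖x + r • y - l • x‖ := by fun_prop
  have hlow : 1 ≤ ‖x + r • y - (0 : ℝ) • x‖ := by
    obtain ⟨p, hp, hpx, hpy⟩ := hyx
    have h := (le_abs_self _).trans (p.le_opNorm (x + r • y))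
    simpa [hp, hpx, hpy, hx] using h
  have hup : ‖x + r • y - (1 - a) • x‖ ≤ 1 := by
    convert h using 2
    module
  obtain ⟨l, hl, hl1⟩ := intermediate_value_Icc' (sub_nonneg.2 ha) hc.continuousOn ⟨hup, hlow⟩
  exact ((isLeast_supportingDepth hx hy hyx h0 h1).1.2 hl1).trans hl.2

theorem supportingDepthMin_nonneg (hx : ‖x‖ = 1) (hy : ‖y‖ = 1) (hyx : QuasiOrthogonal y x)
    (h0 : 0 ≤ r) (h1 : r ≤ 1) : 0 ≤ supportingDepthMin x y r :=
  le_min (isLeast_supportingDepth hx hy hyx h0 h1).2.1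
    (isLeast_supportingDepth hx (by rwa [norm_neg]) hyx.neg_left h0 h1).2.1

theorem supportingDepthMax_le_one (hx : ‖x‖ = 1) (hy : ‖y‖ = 1) (hyx : QuasiOrthogonal y x)
    (h0 : 0 ≤ r) (h1 : r ≤ 1) : supportingDepthMax x y r ≤ 1 :=
  max_le (isLeast_supportingDepth hx hy hyx h0 h1).2.2
    (isLeast_supportingDepth hx (by rwa [norm_neg]) hyx.neg_left h0 h1).2.2

theorem supportingConvexity_le_supportingDepth (hx : ‖x‖ = 1) (hy : ‖y‖ = 1)
    (hyx : QuasiOrthogonal y x) (h0 : 0 ≤ r) (h1 : r ≤ 1) :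
    supportingConvexity X r ≤ supportingDepth x y r := by
  have hloc : ∀ x' : X, ‖x'‖ = 1 →
      ∀ a ∈ {a : ℝ | ∃ y, ‖y‖ = 1 ∧ QuasiOrthogonal y x' ∧ a = supportingDepthMin x' y r},
        0 ≤ a := by
    rintro x' hx' a ⟨y', hy', hyx', rfl⟩
    exact supportingDepthMin_nonneg hx' hy' hyx' h0 h1
  calc supportingConvexity X r ≤ localSupportingConvexity x r :=
        csInf_le ⟨0, by rintro _ ⟨x', hx', rfl⟩; exact Real.sInf_nonneg (hloc x' hx')⟩ ⟨x, hx, rfl⟩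
    _ ≤ supportingDepthMin x y r := csInf_le ⟨0, hloc x hx⟩ ⟨y, hy, hyx, rfl⟩
    _ ≤ supportingDepth x y r := min_le_left _ _

/-- The existence hypotheses exclude the default value `sInf ∅ = 0`, which could fall below `a`. -/
theorem le_supportingConvexity (hne : ∃ x : X, ‖x‖ = 1)
    (hex : ∀ x : X, ‖x‖ = 1 → ∃ y : X, ‖y‖ = 1 ∧ QuasiOrthogonal y x)
    (h : ∀ x y : X, ‖x‖ = 1 → ‖y‖ = 1 → QuasiOrthogonal y x → a ≤ supportingDepth x y r) :
    a ≤ supportingConvexity X r := by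
  obtain ⟨x₀, hx₀⟩ := hne
  refine le_csInf ⟨_, x₀, hx₀, rfl⟩ ?_
  rintro _ ⟨x, hx, rfl⟩
  obtain ⟨y₀, hy₀, hyx₀⟩ := hex x hx
  refine le_csInf ⟨_, y₀, hy₀, hyx₀, rfl⟩ ?_
  rintro _ ⟨y, hy, hyx, rfl⟩
  exact le_min (h x y hx hy hyx) (h x (-y) hx (by rwa [norm_neg]) hyx.neg_left)

theorem localSupportingSmoothness_le_one (hx : ‖x‖ = 1) (h1 : r ≤ 1) :
    localSupportingSmoothness x r ≤ 1 := by
  refine Real.sSup_le ?_ zero_le_one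
  rintro _ ⟨y, t, hy, hyx, ht0, ht, rfl⟩
  exact supportingDepthMax_le_one hx hy hyx ht0 (ht.trans h1)

theorem supportingDepth_le_supportingSmoothness (hx : ‖x‖ = 1) (hy : ‖y‖ = 1)
    (hyx : QuasiOrthogonal y x) {t : ℝ} (h0 : 0 ≤ t) (ht : t ≤ r) (h1 : r ≤ 1) :
    supportingDepth x y t ≤ supportingSmoothness X r := by
  calc supportingDepth x y t ≤ supportingDepthMax x y t := le_max_left _ _
    _ ≤ localSupportingSmoothness x t := by
        refine le_csSup ⟨1, ?_⟩ ⟨y, t, hy, hyx, h0, le_rfl, rfl⟩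
        rintro _ ⟨y', t', hy', hyx', ht0, ht', rfl⟩
        exact supportingDepthMax_le_one hx hy' hyx' ht0 (ht'.trans (ht.trans h1))
    _ ≤ supportingSmoothness X r := by
        refine le_csSup ⟨1, ?_⟩ ⟨x, t, hx, h0, ht, rfl⟩
        rintro _ ⟨x', t', hx', -, ht', rfl⟩
        exact localSupportingSmoothness_le_one hx' (ht'.trans h1)

theorem supportingSmoothness_le (ha : 0 ≤ a)
    (h : ∀ (x y : X) (t : ℝ), ‖x‖ = 1 → ‖y‖ = 1 → QuasiOrthogonal y x → 0 ≤ t → t ≤ r →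
      supportingDepth x y t ≤ a) :
    supportingSmoothness X r ≤ a := by
  refine Real.sSup_le ?_ ha
  rintro _ ⟨x, t, hx, -, ht, rfl⟩
  refine Real.sSup_le ?_ ha
  rintro _ ⟨y, s, hy, hyx, hs0, hs, rfl⟩
  exact max_le (h x y s hx hy hyx hs0 (hs.trans ht))
    (h x (-y) s hx (by rwa [norm_neg]) hyx.neg_left hs0 (hs.trans ht))

end Depth

/-! ### Values of the moduli in a Hilbert space -/

section Hilbert

variable {H : Type*} [NormedAddCommGroup H] [InnerProductSpace ℝ H] {x y : H} {r : ℝ}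

/-- The Riesz representative of a supporting functional at `x` is `x` itself, by the equality case
of Cauchy–Schwarz. -/
theorem quasiOrthogonal_iff_inner_eq_zero [CompleteSpace H] (hx : ‖x‖ = 1) :
    QuasiOrthogonal y x ↔ inner ℝ x y = 0 := by
  constructor
  · rintro ⟨p, hp, hpx, hpy⟩
    set z := (InnerProductSpace.toDual ℝ H).symm p with hz
    have hzn : ‖z‖ = 1 := by rw [hz, LinearIsometryEquiv.norm_map, hp]
    have hzp : ∀ w, inner ℝ z w = p w := fun w => InnerProductSpace.toDual_symm_apply
    have hzx : z = x := (inner_eq_one_iff_of_norm_eq_one (𝕜 := ℝ) hzn hx).1 (by rw [hzp, hpx, hx])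
    rw [← hzx, hzp, hpy]
  · intro h
    exact ⟨innerSL ℝ x, by rw [innerSL_apply_norm, hx], by simp [hx], by simpa using h⟩

theorem supportingDepth_of_inner_eq_zero (hx : ‖x‖ = 1) (hy : ‖y‖ = 1)
    (hxy : inner ℝ x y = 0) (h0 : 0 ≤ r) (h1 : r ≤ 1) :
    supportingDepth x y r = 1 - Real.sqrt (1 - r ^ 2) := by
  have key : ∀ l : ℝ, ‖x + r • y - l • x‖ = 1 ↔ (1 - l) ^ 2 = 1 - r ^ 2 := fun l => by
    have h : ‖x + r • y - l • x‖ ^ 2 = (1 - l) ^ 2 + r ^ 2 := by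
      have : x + r • y - l • x = (1 - l) • x + r • y := by module
      rw [this, norm_add_sq_real, norm_smul, norm_smul, hx, hy, inner_smul_left, inner_smul_right,
        hxy]
      simp
    rw [← sq_eq_sq₀ (norm_nonneg _) zero_le_one, h]
    constructor <;> intro h <;> linarith
  have hs : 0 ≤ 1 - r ^ 2 := by nlinarith
  refine IsLeast.csInf_eq ⟨?_, fun l hl => ?_⟩
  · rw [Set.mem_ofPred_eq, key, sub_sub_cancel, Real.sq_sqrt hs]
  · have h := (key l).1 hl
    have := Real.le_sqrt_of_sq_le h.le
    linarith

theorem exists_norm_eq_one_quasiOrthogonal {X : Type*} [NormedAddCommGroup X] [NormedSpace ℝ X]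
    (hX : 2 ≤ Module.rank ℝ X) {x : X} (hx : ‖x‖ = 1) : ∃ y : X, ‖y‖ = 1 ∧ QuasiOrthogonal y x := by
  have hx0 : x ≠ 0 := by rintro rfl; simp at hx
  obtain ⟨v, hv⟩ := exists_linearIndependent_pair_of_one_lt_rank
    (lt_of_lt_of_le (by norm_num) hX) hx0
  rw [LinearIndependent.pair_iff] at hv
  obtain ⟨p, hp, hpx⟩ := exists_dual_vector ℝ x (by rw [hx]; norm_num)
  set w := v - p v • x with hw
  have hw0 : w ≠ 0 := fun h => by simpa using (hv (-p v) 1 (by rw [← h, hw]; module)).2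
  refine ⟨‖w‖⁻¹ • w, norm_smul_inv_norm hw0, p, hp, hpx, ?_⟩
  have hpx' : p x = 1 := by rw [hpx, hx]; simp
  rw [map_smul, hw, map_sub, map_smul, hpx']
  simp

theorem exists_norm_eq_one_of_two_le_rank {X : Type*} [NormedAddCommGroup X] [NormedSpace ℝ X]
    (hX : 2 ≤ Module.rank ℝ X) : ∃ x : X, ‖x‖ = 1 := by
  have : Nontrivial X := by
    rw [← rank_pos_iff_nontrivial (R := ℝ)]
    exact lt_of_lt_of_le (by norm_num) hX
  exact exists_norm_eq X zero_le_one

theorem supportingConvexity_eq_of_innerProductSpace [CompleteSpace H] (hH : 2 ≤ Module.rank ℝ H)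
    (h0 : 0 ≤ r) (h1 : r ≤ 1) : supportingConvexity H r = 1 - Real.sqrt (1 - r ^ 2) := by
  obtain ⟨x, hx⟩ := exists_norm_eq_one_of_two_le_rank hH
  obtain ⟨y, hy, hyx⟩ := exists_norm_eq_one_quasiOrthogonal hH hx
  refine le_antisymm ?_ ?_
  · rw [← supportingDepth_of_inner_eq_zero hx hy ((quasiOrthogonal_iff_inner_eq_zero hx).1 hyx)
      h0 h1]
    exact supportingConvexity_le_supportingDepth hx hy hyx h0 h1
  · refine le_supportingConvexity ⟨x, hx⟩ (fun _ => exists_norm_eq_one_quasiOrthogonal hH)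
      fun x y hx hy hyx => ?_
    rw [supportingDepth_of_inner_eq_zero hx hy ((quasiOrthogonal_iff_inner_eq_zero hx).1 hyx) h0 h1]

theorem supportingSmoothness_eq_of_innerProductSpace [CompleteSpace H] (hH : 2 ≤ Module.rank ℝ H)
    (h0 : 0 ≤ r) (h1 : r ≤ 1) : supportingSmoothness H r = 1 - Real.sqrt (1 - r ^ 2) := by
  obtain ⟨x, hx⟩ := exists_norm_eq_one_of_two_le_rank hH
  obtain ⟨y, hy, hyx⟩ := exists_norm_eq_one_quasiOrthogonal hH hx
  refine le_antisymm (supportingSmoothness_le ?_ fun x y t hx hy hyx ht0 ht => ?_) ?_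
  · rw [sub_nonneg, Real.sqrt_le_one]
    nlinarith
  · rw [supportingDepth_of_inner_eq_zero hx hy ((quasiOrthogonal_iff_inner_eq_zero hx).1 hyx) ht0
      (ht.trans h1)]
    gcongr
  · rw [← supportingDepth_of_inner_eq_zero hx hy ((quasiOrthogonal_iff_inner_eq_zero hx).1 hyx)
      h0 h1]
    exact supportingDepth_le_supportingSmoothness hx hy hyx h0 le_rfl h1

end Hilbert

/-! ### Area arguments in a normed plane -/

section Plane

open Module MeasureTheory Filter Topology

variable {E : Type*} [NormedAddCommGroup E] [NormedSpace ℝ E]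

/-- The area form of a plane with basis `b`: the determinant of the coordinates. -/
noncomputable def planeForm (b : Basis (Fin 2) ℝ E) (x y : E) : ℝ :=
  b.repr x 0 * b.repr y 1 - b.repr x 1 * b.repr y 0

variable (b : Basis (Fin 2) ℝ E)

theorem planeForm_self (x : E) : planeForm b x x = 0 := by simp only [planeForm]; ring

theorem planeForm_swap (x y : E) : planeForm b x y = -planeForm b y x := by
  simp only [planeForm]; ring

theorem planeForm_add_left (x y z : E) :
    planeForm b (x + y) z = planeForm b x z + planeForm b y z := by
  simp only [planeForm, map_add, Finsupp.add_apply]; ring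

theorem planeForm_smul_left (c : ℝ) (x y : E) : planeForm b (c • x) y = c * planeForm b x y := by
  simp only [planeForm, map_smul, Finsupp.smul_apply, smul_eq_mul]; ring

theorem planeForm_sub_left (x y z : E) :
    planeForm b (x - y) z = planeForm b x z - planeForm b y z := by
  simp only [planeForm, map_sub, Finsupp.sub_apply]; ring

theorem planeForm_add_right (x y z : E) :
    planeForm b x (y + z) = planeForm b x y + planeForm b x z := by
  simp only [planeForm, map_add, Finsupp.add_apply]; ring

theorem planeForm_smul_right (c : ℝ) (x y : E) : planeForm b x (c • y) = c * planeForm b x y := by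
  simp only [planeForm, map_smul, Finsupp.smul_apply, smul_eq_mul]; ring

theorem exists_planeForm_ne_zero {y : E} (hy : y ≠ 0) : ∃ x, planeForm b x y ≠ 0 := by
  by_contra! h
  apply hy
  have h0 := h (b 0)
  have h1 := h (b 1)
  simp only [planeForm, Basis.repr_self, Finsupp.single_apply] at h0 h1
  apply b.ext_elem
  intro i
  fin_cases i
  · simpa using h1
  · simpa using h0

theorem continuous_planeForm : Continuous fun p : E × E => planeForm b p.1 p.2 := by
  have := b.finiteDimensional_of_finite
  have h : ∀ i, Continuous fun x : E => b.repr x i :=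
    fun i => (b.coord i).continuous_of_finiteDimensional
  have h0 := h 0
  have h1 := h 1
  unfold planeForm
  fun_prop

/-- The functional `x ↦ planeForm b x y`. -/
noncomputable def planeFormDual (y : E) : StrongDual ℝ E where
  toFun x := planeForm b x y
  map_add' x z := planeForm_add_left b x z y
  map_smul' c x := planeForm_smul_left b c x y
  cont := (continuous_planeForm b).comp (by fun_prop : Continuous fun x : E => (x, y))

theorem planeFormDual_apply (x y : E) : planeFormDual b y x = planeForm b x y := rfl

theorem planeFormDual_ne_zero {y : E} (hy : y ≠ 0) : planeFormDual b y ≠ 0 := by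
  obtain ⟨x, hx⟩ := exists_planeForm_ne_zero b hy
  intro h
  exact hx (by rw [← planeFormDual_apply, h]; rfl)

theorem quasiOrthogonal_of_planeForm_le {x y : E} (hx : ‖x‖ ≤ 1) (hy : y ≠ 0)
    (h : ∀ z, ‖z‖ ≤ 1 → planeForm b z y ≤ planeForm b x y) : ‖x‖ = 1 ∧ QuasiOrthogonal y x :=
  quasiOrthogonal_of_forall_le (planeFormDual_ne_zero b hy) hx h (planeForm_self b y)

/-- Every point outside the convex hull of a finite set lies on an oriented support ray of that
set. -/
theorem exists_supporting_vertex {F : Finset E} (hF : F.Nonempty) {c : ℝ} (hc : 0 < c) {v : E}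
    (hv : v ∉ convexHull ℝ ((c • · : E → E) '' F)) :
    ∃ x ∈ F, ∀ x' ∈ F, planeForm b x' (v - c • x) ≤ planeForm b x (v - c • x) := by
  have hfin : ((c • · : E → E) '' (F : Set E)).Finite := F.finite_toSet.image _
  obtain ⟨f, u, hfu, huv⟩ :=
    geometric_hahn_banach_closed_point (convex_convexHull ℝ _) (hfin.isClosed_convexHull ℝ) hv
  have hpos : ∀ x ∈ F, 0 < f (v - c • x) := fun x hx => by
    have := hfu (c • x) (subset_convexHull ℝ _ ⟨x, hx, rfl⟩)
    rw [map_sub]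
    linarith
  set α := f (b 0) with hα
  set β := f (b 1) with hβ
  have hf : ∀ z, f z = α * b.repr z 0 + β * b.repr z 1 := fun z => by
    conv_lhs => rw [← b.sum_repr z]
    simp only [Fin.sum_univ_two, map_add, map_smul, smul_eq_mul, hα, hβ]
    ring
  -- With `k` as second coordinate next to `f`, `planeForm` is a positive multiple of `f ∧ k`. Since
  -- `f > 0` on all `v - c • x`, maximizing the slope `k / f` selects an extreme direction.
  let k : E → ℝ := fun z => -β * b.repr z 0 + α * b.repr z 1
  have hk : ∀ z w, planeForm b z w * (α ^ 2 + β ^ 2) = f z * k w - k z * f w := fun z w => by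
    simp only [planeForm, hf, k]
    ring
  have hαβ : 0 < α ^ 2 + β ^ 2 := by
    obtain ⟨x, hx⟩ := hF
    have h := hpos x hx
    by_contra! h'
    have hα0 : α = 0 := by nlinarith [sq_nonneg α, sq_nonneg β]
    have hβ0 : β = 0 := by nlinarith [sq_nonneg α, sq_nonneg β]
    rw [hf, hα0, hβ0] at h
    simp at h
  obtain ⟨x, hx, hmax⟩ := F.exists_max_image (fun x => k (v - c • x) / f (v - c • x)) hF
  refine ⟨x, hx, fun x' hx' => ?_⟩
  have h1 := hmax x' hx'
  rw [div_le_div_iff₀ (hpos x' hx') (hpos x hx)] at h1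
  have h2 : 0 ≤ planeForm b (v - c • x') (v - c • x) := by
    have := hk (v - c • x') (v - c • x)
    by_contra! h3
    nlinarith
  have h3 : v - c • x' = (v - c • x) - c • (x' - x) := by module
  rw [h3, planeForm_sub_left, planeForm_self, planeForm_smul_left, planeForm_sub_left] at h2
  by_contra! h4
  nlinarith

/-- The cone of directions `y` such that the line through `x` along `y` supports `F` with `F` on
its left. -/
def supportCone (F : Finset E) (x : E) : Set E :=
  {y | ∀ x' ∈ F, planeForm b x' y ≤ planeForm b x y}

theorem isClosed_supportCone (F : Finset E) (x : E) : IsClosed (supportCone b F x) := by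
  have h : ∀ z, Continuous fun y => planeForm b z y := fun z =>
    (continuous_planeForm b).comp (by fun_prop : Continuous fun y : E => (z, y))
  have : supportCone b F x = ⋂ x' ∈ F, {y | planeForm b x' y ≤ planeForm b x y} := by
    ext; simp [supportCone]
  rw [this]
  exact isClosed_biInter fun x' _ => isClosed_le (h x') (h x)

theorem smul_mem_supportCone {F : Finset E} {x y : E} (h : y ∈ supportCone b F x) {t : ℝ}
    (ht : 0 ≤ t) : t • y ∈ supportCone b F x := fun x' hx' => by
  rw [planeForm_smul_right, planeForm_smul_right]
  exact mul_le_mul_of_nonneg_left (h x' hx') ht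

section Measure

variable [MeasurableSpace E] [BorelSpace E] (μ : Measure E) [μ.IsAddHaarMeasure]

/-- A common direction supports at both points, hence is parallel to `x - x'`; a line is null. -/
theorem aedisjoint_supportCone {F : Finset E} {x x' : E} (hx : x ∈ F) (hx' : x' ∈ F)
    (hne : x ≠ x') : AEDisjoint μ (supportCone b F x) (supportCone b F x') := by
  have := b.finiteDimensional_of_finite
  have hne' : x - x' ≠ 0 := sub_ne_zero.2 hne
  refine measure_mono_null (t := LinearMap.ker (planeFormDual b (x - x')).toLinearMap) ?_
    (Measure.addHaar_submodule μ _ ?_)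
  · rintro y ⟨hy, hy'⟩
    have h : planeForm b (x - x') y = 0 := by
      rw [planeForm_sub_left]
      linarith [hy x' hx', hy' x hx]
    change planeForm b y (x - x') = 0
    rw [planeForm_swap, h, neg_zero]
  · intro h
    obtain ⟨z, hz⟩ := exists_planeForm_ne_zero b hne'
    exact hz (LinearMap.congr_fun (LinearMap.ker_eq_top.1 h) z)

/-- The area swept by tangent segments of length at most `r` around a polygon is at most the area of
the ball of radius `r`. -/
theorem measure_biUnion_tangent_le (F : Finset E) (c r : ℝ) :
    μ (⋃ x ∈ F, (c • x + ·) '' (supportCone b F x ∩ Metric.closedBall 0 r)) ≤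
      μ (Metric.closedBall 0 r) := by
  calc μ (⋃ x ∈ F, (c • x + ·) '' (supportCone b F x ∩ Metric.closedBall 0 r))
      ≤ ∑ x ∈ F, μ ((c • x + ·) '' (supportCone b F x ∩ Metric.closedBall 0 r)) :=
        measure_biUnion_finset_le _ _
    _ = ∑ x ∈ F, μ (supportCone b F x ∩ Metric.closedBall 0 r) := by
        simp only [Set.image_add_left, measure_preimage_add]
    _ = μ (⋃ x ∈ F, supportCone b F x ∩ Metric.closedBall 0 r) := by
        refine (measure_biUnion_finset₀ ?_ fun x _ => ?_).symm
        · intro x hx x' hx' hne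
          exact (aedisjoint_supportCone b μ hx hx' hne).mono Set.inter_subset_left
            Set.inter_subset_left
        · exact ((isClosed_supportCone b F x).inter
            Metric.isClosed_closedBall).measurableSet.nullMeasurableSet
    _ ≤ μ (Metric.closedBall 0 r) :=
        measure_mono (Set.iUnion₂_subset fun _ _ => Set.inter_subset_right)

end Measure

theorem exists_norm_add_le_of_finset {F : Finset E} (hF : F.Nonempty) (hF1 : ∀ x ∈ F, ‖x‖ ≤ 1)
    {c r : ℝ} (hc : 0 < c) (hr : 0 < r) (hcr : c ^ 2 + r ^ 2 = 1) {δ : ℝ} (hδ : 0 < δ) :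
    ∃ x ∈ F, ∃ y ∈ supportCone b F x, ‖y‖ = 1 ∧ ‖c • x + r • y‖ ≤ 1 + δ := by
  by_contra! hcon
  have := b.finiteDimensional_of_finite
  let _ : MeasurableSpace E := borel E
  have : BorelSpace E := ⟨rfl⟩
  let μ : Measure E := Measure.addHaar
  have hc1 : c ≤ 1 := by nlinarith
  -- Under the contrary assumption, tangent segments of length at most `r` already reach the whole
  -- enlarged ball.
  have hsub : Metric.closedBall (0 : E) (1 + δ) ⊆ Metric.closedBall 0 c ∪
      ⋃ x ∈ F, (c • x + ·) '' (supportCone b F x ∩ Metric.closedBall 0 r) := by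
    intro v hv
    rw [mem_closedBall_zero_iff] at hv
    by_cases hvc : v ∈ convexHull ℝ ((c • · : E → E) '' F)
    · left
      refine convexHull_min ?_ (convex_closedBall (0 : E) c) hvc
      rintro _ ⟨x, hx, rfl⟩
      rw [mem_closedBall_zero_iff, norm_smul, Real.norm_of_nonneg hc.le]
      exact mul_le_of_le_one_right hc.le (hF1 x hx)
    · right
      obtain ⟨x, hx, hy⟩ := exists_supporting_vertex b hF hc hvc
      set y := v - c • x with hyd
      refine Set.mem_biUnion hx ⟨y, ⟨hy, ?_⟩, by simp [hyd]⟩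
      rw [mem_closedBall_zero_iff]
      -- Otherwise the point at distance `r` from `c • x` towards `v` lies on a segment inside the
      -- enlarged ball, against `hcon`.
      by_contra! hry
      have hy0 : 0 < ‖y‖ := hr.trans hry
      refine absurd (hcon x hx (‖y‖⁻¹ • y) (smul_mem_supportCone b hy (by positivity))
        (norm_smul_inv_norm (norm_pos_iff.1 hy0))) (not_lt.2 ?_)
      have ht0 : 0 ≤ r * ‖y‖⁻¹ := by positivity
      have ht1 : r * ‖y‖⁻¹ ≤ 1 := by
        rw [← div_eq_mul_inv, div_le_one hy0]
        exact hry.le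
      have hcx : c • x ∈ Metric.closedBall (0 : E) (1 + δ) := by
        rw [mem_closedBall_zero_iff, norm_smul, Real.norm_of_nonneg hc.le]
        nlinarith [hF1 x hx, norm_nonneg x]
      have hv' : v ∈ Metric.closedBall (0 : E) (1 + δ) := by rwa [mem_closedBall_zero_iff]
      have hmem := convex_closedBall (0 : E) (1 + δ) hcx hv' (sub_nonneg.2 ht1) ht0
        (sub_add_cancel _ _)
      rw [mem_closedBall_zero_iff] at hmem
      have hvy : v = c • x + y := by rw [hyd]; abel
      have hvec : c • x + r • ‖y‖⁻¹ • y =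
          (1 - r * ‖y‖⁻¹) • c • x + (r * ‖y‖⁻¹) • v := by
        generalize y = y' at hvy ⊢
        rw [hvy]
        module
      rwa [hvec]
  have hle := (measure_mono hsub).trans (measure_union_le _ _) |>.trans
    (add_le_add le_rfl (measure_biUnion_tangent_le b μ F c r))
  have hfr : finrank ℝ E = 2 := by simpa using finrank_eq_card_basis b
  rw [Measure.addHaar_closedBall' μ _ (by positivity : (0 : ℝ) ≤ 1 + δ),
    Measure.addHaar_closedBall' μ _ hc.le, Measure.addHaar_closedBall' μ _ hr.le, hfr, ← add_mul,
    ← ENNReal.ofReal_add (by positivity) (by positivity), hcr] at hle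
  have hA0 : μ (Metric.closedBall (0 : E) 1) ≠ 0 :=
    (Metric.measure_closedBall_pos μ _ one_pos).ne'
  have hA1 : μ (Metric.closedBall (0 : E) 1) ≠ ⊤ := measure_closedBall_lt_top.ne
  rw [ENNReal.mul_le_mul_iff_left hA0 hA1, ENNReal.ofReal_le_ofReal_iff zero_le_one] at hle
  nlinarith

include b in
/-- In a normed plane, for each point of the Euclidean circle there is a pair of unit vectors, the
second quasiorthogonal to the first, for which the combination with these coordinates lies in the
unit ball. -/
theorem exists_quasiOrthogonal_norm_add_le {c r : ℝ} (hc : 0 < c) (hr : 0 < r)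
    (hcr : c ^ 2 + r ^ 2 = 1) :
    ∃ x y : E, ‖x‖ = 1 ∧ ‖y‖ = 1 ∧ QuasiOrthogonal y x ∧ ‖c • x + r • y‖ ≤ 1 := by
  have := b.finiteDimensional_of_finite
  have : ProperSpace E := FiniteDimensional.proper ℝ E
  -- Apply the finite version to a `1 / (n + 1)`-net of the ball: supporting the net becomes
  -- supporting the ball in the limit.
  have hstep : ∀ n : ℕ, ∃ p : E × E, (‖p.1‖ ≤ 1 ∧ ‖p.2‖ = 1) ∧
      ‖c • p.1 + r • p.2‖ ≤ 1 + 1 / ((n : ℝ) + 1) ∧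
      ∀ z, ‖z‖ ≤ 1 → ∃ z', dist z z' < 1 / ((n : ℝ) + 1) ∧
        planeForm b z' p.2 ≤ planeForm b p.1 p.2 := by
    intro n
    have hn : (0 : ℝ) < 1 / ((n : ℝ) + 1) := by positivity
    obtain ⟨T, hTs, hTf, hT⟩ :=
      finite_cover_balls_of_compact (isCompact_closedBall (0 : E) 1) hn
    have hcov : ∀ z : E, ‖z‖ ≤ 1 → ∃ z' ∈ T, dist z z' < 1 / ((n : ℝ) + 1) := fun z hz => by
      simpa using hT (mem_closedBall_zero_iff.2 hz)
    obtain ⟨x₀, hx₀, -⟩ := hcov 0 (by simp)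
    obtain ⟨x, hx, y, hy, hy1, hxy⟩ := exists_norm_add_le_of_finset b (F := hTf.toFinset)
      ⟨x₀, by simpa using hx₀⟩
      (fun x hx => mem_closedBall_zero_iff.1 (hTs (by simpa using hx))) hc hr hcr hn
    refine ⟨(x, y), ⟨mem_closedBall_zero_iff.1 (hTs (by simpa using hx)), hy1⟩, hxy,
      fun z hz => ?_⟩
    obtain ⟨z', hz', hd⟩ := hcov z hz
    exact ⟨z', hd, hy z' (by simpa using hz')⟩
  choose p hp1 hp2 hp3 using hstep
  have hK : IsCompact (Metric.closedBall (0 : E) 1 ×ˢ Metric.sphere (0 : E) 1) :=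
    (isCompact_closedBall _ _).prod (isCompact_sphere _ _)
  obtain ⟨⟨x, y⟩, hxyK, φ, hφ, hlim⟩ := hK.tendsto_subseq (x := p) fun n => by
    simpa using hp1 n
  have hx : ‖x‖ ≤ 1 := by simpa using hxyK.1
  have hy : ‖y‖ = 1 := by simpa using hxyK.2
  have hlim1 : Tendsto (fun n => (p (φ n)).1) atTop (𝓝 x) :=
    (continuous_fst.tendsto _).comp hlim
  have hlim2 : Tendsto (fun n => (p (φ n)).2) atTop (𝓝 y) :=
    (continuous_snd.tendsto _).comp hlim
  have hε : Tendsto (fun n => 1 / ((φ n : ℝ) + 1)) atTop (𝓝 0) :=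
    tendsto_one_div_add_atTop_nhds_zero_nat.comp hφ.tendsto_atTop
  have hsup : ∀ z, ‖z‖ ≤ 1 → planeForm b z y ≤ planeForm b x y := by
    intro z hz
    choose z' hz' hle using fun n => hp3 (φ n) z hz
    have hz'lim : Tendsto z' atTop (𝓝 z) := by
      rw [tendsto_iff_dist_tendsto_zero]
      exact squeeze_zero (fun _ => dist_nonneg) (fun n => by rw [dist_comm]; exact (hz' n).le) hε
    exact le_of_tendsto_of_tendsto'
      (((continuous_planeForm b).tendsto (z, y)).comp (hz'lim.prodMk_nhds hlim2))
      (((continuous_planeForm b).tendsto (x, y)).comp (hlim1.prodMk_nhds hlim2)) hle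
  obtain ⟨hx1, hyx⟩ :=
    quasiOrthogonal_of_planeForm_le b hx (norm_ne_zero_iff.1 (by rw [hy]; norm_num)) hsup
  refine ⟨x, y, hx1, hy, hyx, ?_⟩
  have h1 : Tendsto (fun n => 1 + 1 / ((φ n : ℝ) + 1)) atTop (𝓝 1) := by
    simpa using hε.const_add 1
  exact le_of_tendsto_of_tendsto' ((hlim1.const_smul c).add (hlim2.const_smul r)).norm h1
    fun n => hp2 (φ n)

include b in
/-- A normed plane contains two unit vectors, each quasiorthogonal to the other, for which rotation
through any angle does not bring both into the open unit ball. -/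
theorem exists_quasiOrthogonal_pair_one_le_norm :
    ∃ x y : E, ‖x‖ = 1 ∧ ‖y‖ = 1 ∧ QuasiOrthogonal y x ∧ QuasiOrthogonal (-x) y ∧
      ∀ c r : ℝ, c ^ 2 + r ^ 2 = 1 → ‖c • x + r • y‖ < 1 → 1 ≤ ‖c • y + r • -x‖ := by
  have := b.finiteDimensional_of_finite
  have : ProperSpace E := FiniteDimensional.proper ℝ E
  have hK : IsCompact (Metric.closedBall (0 : E) 1 ×ˢ Metric.closedBall (0 : E) 1) :=
    (isCompact_closedBall _ _).prod (isCompact_closedBall _ _)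
  obtain ⟨⟨x, y⟩, hxyK, hmax⟩ := hK.exists_isMaxOn ⟨(0, 0), by simp⟩
    (continuous_planeForm b).continuousOn
  have hx : ‖x‖ ≤ 1 := by simpa using hxyK.1
  have hy : ‖y‖ ≤ 1 := by simpa using hxyK.2
  have hle : ∀ u v : E, ‖u‖ ≤ 1 → ‖v‖ ≤ 1 → planeForm b u v ≤ planeForm b x y := fun u v hu hv =>
    hmax (show (u, v) ∈ _ from ⟨by simpa using hu, by simpa using hv⟩)
  have hpos : 0 < planeForm b x y := by
    refine lt_of_lt_of_le ?_ (hle (‖b 0‖⁻¹ • b 0) (‖b 1‖⁻¹ • b 1)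
      (norm_smul_inv_norm (b.ne_zero 0)).le (norm_smul_inv_norm (b.ne_zero 1)).le)
    rw [planeForm_smul_left, planeForm_smul_right]
    simp only [planeForm, Basis.repr_self, Finsupp.single_apply]
    simp only [Fin.isValue, if_true, one_ne_zero, zero_ne_one, if_false]
    have := norm_pos_iff.2 (b.ne_zero 0)
    have := norm_pos_iff.2 (b.ne_zero 1)
    norm_num
    positivity
  have hx0 : x ≠ 0 := by
    rintro rfl
    simp [planeForm] at hpos
  have hy0 : y ≠ 0 := by
    rintro rfl
    simp [planeForm] at hpos
  have hswap : ∀ z, planeForm b z (-x) = planeForm b x z := fun z => by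
    rw [← neg_one_smul ℝ x, planeForm_smul_right, planeForm_swap]; ring
  obtain ⟨hx1, hyx⟩ := quasiOrthogonal_of_planeForm_le b hx hy0 fun z hz => hle z y hz hy
  obtain ⟨hy1, hxy⟩ := quasiOrthogonal_of_planeForm_le b (y := -x) hy (neg_ne_zero.2 hx0)
    fun z hz => by rw [hswap, hswap]; exact hle x z hx hz
  refine ⟨x, y, hx1, hy1, hyx, hxy, fun c r hcr h1 => ?_⟩
  by_contra! h2
  set u := c • x + r • y with hu
  set v := c • y + r • -x with hv
  have huv : planeForm b u v = planeForm b x y := by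
    rw [hu, hv]
    simp only [planeForm_add_left, planeForm_add_right, planeForm_smul_left, planeForm_smul_right,
      hswap, planeForm_self]
    linear_combination planeForm b x y * hcr
  have hu0 : u ≠ 0 := by
    intro h
    rw [h] at huv
    simp [planeForm] at huv
    simp [planeForm] at hpos
    linarith
  have hun : 0 < ‖u‖ := norm_pos_iff.2 hu0
  -- Normalizing `u`, which is shorter than 1, would strictly increase the maximal area.
  have h3 := hle (‖u‖⁻¹ • u) v (norm_smul_inv_norm hu0).le h2.le
  rw [planeForm_smul_left, huv] at h3
  have h4 : 1 < ‖u‖⁻¹ := (one_lt_inv₀ hun).2 h1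
  nlinarith

end Plane

/-! ### Comparison with the Hilbert values -/

section Comparison

open Module

variable {X : Type*} [NormedAddCommGroup X] [NormedSpace ℝ X]

theorem exists_submodule_basis_fin_two (hX : 2 ≤ Module.rank ℝ X) :
    ∃ S : Submodule ℝ X, Nonempty (Basis (Fin 2) ℝ S) := by
  have h2 : ((2 : ℕ) : Cardinal) ≤ Module.rank ℝ X := by exact_mod_cast hX
  obtain ⟨v, hv⟩ := Module.le_rank_iff.1 h2
  exact ⟨_, ⟨Basis.span hv⟩⟩

theorem supportingConvexity_le_one_sub_sqrt (hX : 2 ≤ Module.rank ℝ X) {r : ℝ} (h0 : 0 ≤ r)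
    (h1 : r ≤ 1) : supportingConvexity X r ≤ 1 - Real.sqrt (1 - r ^ 2) := by
  obtain ⟨x₀, hx₀⟩ := exists_norm_eq_one_of_two_le_rank hX
  obtain ⟨y₀, hy₀, hyx₀⟩ := exists_norm_eq_one_quasiOrthogonal hX hx₀
  have hs : 0 ≤ 1 - r ^ 2 := by nlinarith
  have hsq := Real.sq_sqrt hs
  have hs1 : Real.sqrt (1 - r ^ 2) ≤ 1 := by rw [Real.sqrt_le_one]; nlinarith
  -- The area argument needs both coordinates positive; at the endpoints the test vector is `x` or
  -- `y` alone.
  rcases h0.eq_or_lt with rfl | hr0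
  · refine (supportingConvexity_le_supportingDepth hx₀ hy₀ hyx₀ h0 h1).trans ?_
    exact supportingDepth_le_of_norm_le hx₀ hy₀ hyx₀ h0 h1 hs1 (by simp [hx₀])
  rcases h1.eq_or_lt with rfl | hr1
  · refine (supportingConvexity_le_supportingDepth hx₀ hy₀ hyx₀ h0 h1).trans ?_
    exact supportingDepth_le_of_norm_le hx₀ hy₀ hyx₀ h0 h1 hs1 (by simp [hy₀])
  obtain ⟨S, ⟨b⟩⟩ := exists_submodule_basis_fin_two hX
  have hc : 0 < Real.sqrt (1 - r ^ 2) := Real.sqrt_pos.2 (by nlinarith)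
  obtain ⟨x, y, hx, hy, hyx, hxy⟩ :=
    exists_quasiOrthogonal_norm_add_le b hc hr0 (by rw [hsq]; ring)
  have hx' : ‖(x : X)‖ = 1 := hx
  have hy' : ‖(y : X)‖ = 1 := hy
  exact (supportingConvexity_le_supportingDepth hx' hy' hyx.coe h0 h1).trans
    (supportingDepth_le_of_norm_le hx' hy' hyx.coe h0 h1 hs1 hxy)

/-- The point is a convex combination, with positive weight on the second, of a point of the sphere
and of `r • y`, which is in the open ball because `r < 1`. -/
theorem norm_lt_one_of_supportingDepth_lt {x y : X} (hx : ‖x‖ = 1) (hy : ‖y‖ = 1)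
    (hyx : QuasiOrthogonal y x) {c r : ℝ} (h0 : 0 ≤ r) (h1 : r < 1) (hc : 0 ≤ c)
    (h : supportingDepth x y r < 1 - c) : ‖c • x + r • y‖ < 1 := by
  have hz := norm_supportingDepth hx hy hyx h0 h1.le
  set a := 1 - supportingDepth x y r with ha
  have hca : c < a := by linarith
  have ha0 : 0 < a := by linarith
  have hvec : c • x + r • y = (c / a) • (a • x + r • y) + (1 - c / a) • r • y := by
    have : c • x = (c / a) • a • x := by rw [smul_smul, div_mul_cancel₀ _ ha0.ne']
    rw [this]
    module
  have hlt : c / a < 1 := (div_lt_one ha0).2 hca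
  have hnn : 0 ≤ c / a := by positivity
  rw [hvec]
  refine (norm_add_le _ _).trans_lt ?_
  rw [norm_smul, hz, norm_smul, norm_smul, hy, Real.norm_of_nonneg hnn,
    Real.norm_of_nonneg (sub_nonneg.2 hlt.le), Real.norm_of_nonneg h0]
  nlinarith

theorem exists_one_sub_le_supportingDepth (hX : 2 ≤ Module.rank ℝ X) {c r : ℝ} (h0 : 0 ≤ r)
    (h1 : r < 1) (hc : 0 ≤ c) (hcr : c ^ 2 + r ^ 2 = 1) :
    ∃ x y : X, ‖x‖ = 1 ∧ ‖y‖ = 1 ∧ QuasiOrthogonal y x ∧ 1 - c ≤ supportingDepth x y r := by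
  obtain ⟨S, ⟨b⟩⟩ := exists_submodule_basis_fin_two hX
  obtain ⟨x, y, hx, hy, hyx, hxy, h⟩ := exists_quasiOrthogonal_pair_one_le_norm b
  have hx' : ‖(x : X)‖ = 1 := hx
  have hy' : ‖(y : X)‖ = 1 := hy
  have hnx : ‖((-x : S) : X)‖ = 1 := (norm_neg x).trans hx
  by_contra! hcon
  refine absurd (h c r hcr ?_) (not_le.2 ?_)
  · exact norm_lt_one_of_supportingDepth_lt hx' hy' hyx.coe h0 h1 hc (hcon _ _ hx' hy' hyx.coe)
  · exact norm_lt_one_of_supportingDepth_lt hy' hnx hxy.coe h0 h1 hc (hcon _ _ hy' hnx hxy.coe)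

theorem one_sub_sqrt_le_supportingSmoothness (hX : 2 ≤ Module.rank ℝ X) {r : ℝ} (h0 : 0 ≤ r)
    (h1 : r ≤ 1) : 1 - Real.sqrt (1 - r ^ 2) ≤ supportingSmoothness X r := by
  have key : ∀ c t : ℝ, 0 ≤ c → 0 ≤ t → t ≤ r → t < 1 → c ^ 2 + t ^ 2 = 1 →
      1 - c ≤ supportingSmoothness X r := fun c t hc ht htr ht1 hct => by
    obtain ⟨x, y, hx, hy, hyx, h⟩ := exists_one_sub_le_supportingDepth hX ht ht1 hc hct
    exact h.trans (supportingDepth_le_supportingSmoothness hx hy hyx ht htr h1)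
  rcases h1.eq_or_lt with rfl | hr1
  · have : Real.sqrt (1 - 1 ^ 2) = 0 := by simp
    rw [this, sub_zero]
    -- The depth estimate requires `t < 1`, so `r = 1` is approached by `t = √(1 - c²)` with small
    -- `c`, using the supremum over `t ≤ r`.
    refine le_of_forall_pos_sub_le fun ε hε => ?_
    set c := min ε 1 with hc
    have hc0 : 0 < c := lt_min hε one_pos
    have hc1 : c ≤ 1 := min_le_right _ _
    have hs : 0 ≤ 1 - c ^ 2 := by nlinarith
    have hs1 : Real.sqrt (1 - c ^ 2) < 1 := by
      rw [Real.sqrt_lt' one_pos]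
      nlinarith
    have := key c (Real.sqrt (1 - c ^ 2)) hc0.le (Real.sqrt_nonneg _) hs1.le hs1
      (by rw [Real.sq_sqrt hs]; ring)
    linarith [min_le_left ε 1]
  · exact key _ r (Real.sqrt_nonneg _) h0 le_rfl hr1 (by
      rw [Real.sq_sqrt (by nlinarith)]; ring)

end Comparison

/-! ### Equality characterizes Hilbert spaces -/

section Rigidity

variable {X : Type*} [NormedAddCommGroup X] [NormedSpace ℝ X]

/-- If the norm of `X` is Euclidean with respect to each pair of quasiorthogonal unit vectors, then
`X` is a Hilbert space. -/
theorem isHilbertSpace_of_norm_sq_eq [CompleteSpace X]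
    (h : ∀ x y : X, ‖x‖ = 1 → ‖y‖ = 1 → QuasiOrthogonal y x →
      ∀ a b : ℝ, ‖a • x + b • y‖ ^ 2 = a ^ 2 + b ^ 2) : IsHilbertSpace X := by
  refine ⟨‹_›, InnerProductSpace.ofNorm ℝ fun u v => ?_, rfl⟩
  by_cases hu : u = 0
  · subst hu
    simp only [zero_add, zero_sub, norm_neg, norm_zero]
    ring
  set x := ‖u‖⁻¹ • u with hxd
  have hx : ‖x‖ = 1 := norm_smul_inv_norm hu
  have hux : u = ‖u‖ • x := by rw [hxd, smul_inv_smul₀ (norm_ne_zero_iff.2 hu)]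
  obtain ⟨p, hp, hpx⟩ := exists_dual_vector ℝ x (by rw [hx]; norm_num)
  have hpx1 : p x = 1 := by rw [hpx, hx]; rfl
  set α := ‖u‖
  set w := v - p v • x with hw
  by_cases hw0 : w = 0
  · have hv : v = p v • x := by rwa [hw, sub_eq_zero] at hw0
    rw [hux, hv, ← add_smul, ← sub_smul]
    simp only [norm_smul, hx, mul_one, Real.norm_eq_abs, abs_mul_abs_self]
    ring
  set y := ‖w‖⁻¹ • w with hyd
  have hy : ‖y‖ = 1 := norm_smul_inv_norm hw0
  have hyx : QuasiOrthogonal y x := by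
    refine ⟨p, hp, by rw [hpx1, hx], ?_⟩
    rw [hyd, map_smul, hw, map_sub, map_smul, hpx1]
    simp
  have hwy : w = ‖w‖ • y := by rw [hyd, smul_inv_smul₀ (norm_ne_zero_iff.2 hw0)]
  have hv : v = p v • x + ‖w‖ • y := by rw [← hwy, hw]; abel
  have hq := h x y hx hy hyx
  have e1 : u + v = (α + p v) • x + ‖w‖ • y := by
    nth_rw 1 [hux, hv]; module
  have e2 : u - v = (α - p v) • x + (-‖w‖) • y := by
    nth_rw 1 [hux, hv]; module
  have n1 := hq (α + p v) ‖w‖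
  have n2 := hq (α - p v) (-‖w‖)
  have n3 := hq (p v) ‖w‖
  rw [← e1] at n1
  rw [← e2] at n2
  rw [← hv] at n3
  change _ = 2 * (α * α + _)
  linear_combination n1 + n2 - 2 * n3

/-- Every unit vector in the plane of a pair of unit vectors `x, y` belongs to a quasiorthogonal
pair in this plane. -/
theorem exists_quasiOrthogonal_combination {x y : X}
    (hli : ∀ s t : ℝ, s • x + t • y = 0 → s = 0 ∧ t = 0) {z : X} (hz : ‖z‖ = 1) {a b : ℝ} (hab : z = a • x + b • y) :
    ∃ c d : ℝ, ‖c • x + d • y‖ = 1 ∧ QuasiOrthogonal (c • x + d • y) z := by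
  obtain ⟨p, hp, hpz⟩ := exists_dual_vector ℝ z (by rw [hz]; norm_num)
  have hpz1 : p z = 1 := by rw [hpz, hz]; rfl
  -- The combination of `x` and `y` killed by `p`; it is nonzero because `p z = 1`.
  set w := p y • x + (-p x) • y with hw
  have hw0 : w ≠ 0 := fun h0 => by
    obtain ⟨h1, h2⟩ := hli _ _ h0
    rw [hab, map_add, map_smul, map_smul, h1, neg_eq_zero.1 h2] at hpz1
    simp at hpz1
  have hvec : (‖w‖⁻¹ * p y) • x + (‖w‖⁻¹ * -p x) • y = ‖w‖⁻¹ • w := by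
    rw [hw]; module
  refine ⟨‖w‖⁻¹ * p y, ‖w‖⁻¹ * -p x, ?_, p, hp, by rw [hpz1, hz], ?_⟩
  · rw [hvec]; exact norm_smul_inv_norm hw0
  · rw [hvec, hw]
    simp only [map_smul, map_add, smul_eq_mul]
    ring

theorem QuasiOrthogonal.linearIndependent {x y : X} (hx : ‖x‖ = 1) (hy : ‖y‖ = 1)
    (hyx : QuasiOrthogonal y x) (s t : ℝ) (h : s • x + t • y = 0) : s = 0 ∧ t = 0 := by
  obtain ⟨p, -, hpx, hpy⟩ := hyx
  have hs : s = 0 := by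
    have := congrArg p h
    simpa [hpx, hpy, hx] using this
  refine ⟨hs, ?_⟩
  rw [hs, zero_smul, zero_add, smul_eq_zero] at h
  exact h.resolve_right (by rintro rfl; simp at hy)

theorem norm_sq_eq_of_unit {x y : X}
    (h : ∀ a b : ℝ, ‖a • x + b • y‖ = 1 → a ^ 2 + b ^ 2 = 1)
    (hli : ∀ s t : ℝ, s • x + t • y = 0 → s = 0 ∧ t = 0) (a b : ℝ) :
    ‖a • x + b • y‖ ^ 2 = a ^ 2 + b ^ 2 := by
  by_cases h0 : a • x + b • y = 0
  · obtain ⟨rfl, rfl⟩ := hli _ _ h0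
    simp
  have hn : ‖a • x + b • y‖ ≠ 0 := norm_ne_zero_iff.2 h0
  set n := ‖a • x + b • y‖ with hnd
  have := h (n⁻¹ * a) (n⁻¹ * b) (by
    rw [mul_smul, mul_smul, ← smul_add]; exact norm_smul_inv_norm h0)
  field_simp at this
  linarith

/-- For `z` on the sphere and `w` quasiorthogonal to it, let `S, T ≤ 1` be the squared coordinate
lengths and `D` the determinant. The ellipse of `(z, w)` contains `x` and `y`, so `S + T ≤ 2 D²`,
while `D² ≤ S T` by Lagrange's identity. Hence `S = T = 1`. -/
theorem norm_sq_eq_of_ball_subset_ellipse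
    (h : ∀ x y : X, ‖x‖ = 1 → ‖y‖ = 1 → QuasiOrthogonal y x →
      ∀ a b : ℝ, ‖a • x + b • y‖ ≤ 1 → a ^ 2 + b ^ 2 ≤ 1)
    {x y : X} (hx : ‖x‖ = 1) (hy : ‖y‖ = 1) (hyx : QuasiOrthogonal y x) (a b : ℝ) :
    ‖a • x + b • y‖ ^ 2 = a ^ 2 + b ^ 2 := by
  have hli := hyx.linearIndependent hx hy
  refine norm_sq_eq_of_unit (fun a b hz => ?_) hli a b
  obtain ⟨c, d, hw, hwz⟩ := exists_quasiOrthogonal_combination hli hz rfl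
  have hz1 := h x y hx hy hyx a b hz.le
  have hw1 := h x y hx hy hyx c d hw.le
  have hli' := hwz.linearIndependent hz hw
  set D := a * d - b * c with hD
  have hD0 : D ≠ 0 := fun h0 => by
    have e1 : d • (a • x + b • y) + (-b) • (c • x + d • y) = 0 := by
      have : d • (a • x + b • y) + (-b) • (c • x + d • y) = D • x := by rw [hD]; module
      rw [this, h0, zero_smul]
    have e2 : (-c) • (a • x + b • y) + a • (c • x + d • y) = 0 := by
      have : (-c) • (a • x + b • y) + a • (c • x + d • y) = D • y := by rw [hD]; module
      rw [this, h0, zero_smul]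
    obtain ⟨-, hb0⟩ := hli' _ _ e1
    obtain ⟨-, ha0⟩ := hli' _ _ e2
    rw [ha0, neg_eq_zero.1 hb0] at hz
    simp at hz
  have hx' : (d / D) • (a • x + b • y) + (-b / D) • (c • x + d • y) = x := by
    have : (d / D) • (a • x + b • y) + (-b / D) • (c • x + d • y) = (D / D) • x := by
      rw [hD]; module
    rw [this, div_self hD0, one_smul]
  have hy' : (-c / D) • (a • x + b • y) + (a / D) • (c • x + d • y) = y := by
    have : (-c / D) • (a • x + b • y) + (a / D) • (c • x + d • y) = (D / D) • y := by
      rw [hD]; module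
    rw [this, div_self hD0, one_smul]
  have k1 := h _ _ hz hw hwz (d / D) (-b / D) (by rw [hx', hx])
  have k2 := h _ _ hz hw hwz (-c / D) (a / D) (by rw [hy', hy])
  have hDD : 0 < D ^ 2 := by positivity
  rw [div_pow, div_pow, ← add_div, div_le_one hDD] at k1 k2
  have hid : D ^ 2 + (a * c + b * d) ^ 2 = (a ^ 2 + b ^ 2) * (c ^ 2 + d ^ 2) := by
    rw [hD]; ring
  have hle : D ^ 2 ≤ (a ^ 2 + b ^ 2) * (c ^ 2 + d ^ 2) := by
    linarith [sq_nonneg (a * c + b * d)]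
  have hsum : (a ^ 2 + b ^ 2) + (c ^ 2 + d ^ 2) ≤ 2 * D ^ 2 := by linarith
  have hS : 0 ≤ a ^ 2 + b ^ 2 := by positivity
  have hT : 0 ≤ c ^ 2 + d ^ 2 := by positivity
  refine le_antisymm hz1 ?_
  generalize a ^ 2 + b ^ 2 = S at *
  generalize c ^ 2 + d ^ 2 = T at *
  have h1 : S * T ≤ S := mul_le_of_le_one_right hS hw1
  have h2 : S * T ≤ T := mul_le_of_le_one_left hT hz1
  have h3 : S = T := by linarith
  have h4 : 0 < S * T := hDD.trans_le hle
  subst h3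
  by_contra! h5
  nlinarith

/-- Dually, a norm-one functional supporting at `y` must vanish at `x`, so both coordinate
functionals have norm one. Bounding their values on a second pair gives `a² + c² ≤ 1` and `b² + d² ≤
1`, against `a² + b² ≥ 1` and `c² + d² ≥ 1`. -/
theorem norm_sq_eq_of_ellipse_subset_ball
    (h : ∀ x y : X, ‖x‖ = 1 → ‖y‖ = 1 → QuasiOrthogonal y x →
      ∀ a b : ℝ, a ^ 2 + b ^ 2 = 1 → ‖a • x + b • y‖ ≤ 1)
    {x y : X} (hx : ‖x‖ = 1) (hy : ‖y‖ = 1) (hyx : QuasiOrthogonal y x) (a b : ℝ) :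
    ‖a • x + b • y‖ ^ 2 = a ^ 2 + b ^ 2 := by
  have hle : ∀ x y : X, ‖x‖ = 1 → ‖y‖ = 1 → QuasiOrthogonal y x →
      ∀ a b : ℝ, ‖a • x + b • y‖ ^ 2 ≤ a ^ 2 + b ^ 2 := by
    intro x y hx hy hyx a b
    rcases (add_nonneg (sq_nonneg a) (sq_nonneg b)).eq_or_lt with h0 | h0
    · have ha : a = 0 := by nlinarith [sq_nonneg a, sq_nonneg b]
      have hb : b = 0 := by nlinarith [sq_nonneg a, sq_nonneg b]
      simp [ha, hb]
    set n := Real.sqrt (a ^ 2 + b ^ 2) with hn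
    have hn0 : 0 < n := Real.sqrt_pos.2 h0
    have hnsq : n ^ 2 = a ^ 2 + b ^ 2 := Real.sq_sqrt h0.le
    have h1 := h x y hx hy hyx (n⁻¹ * a) (n⁻¹ * b) (by field_simp; linarith)
    rw [mul_smul, mul_smul, ← smul_add, norm_smul, norm_inv, Real.norm_of_nonneg hn0.le,
      inv_mul_le_one₀ hn0] at h1
    rw [← hnsq]
    gcongr
  -- A norm-one functional takes on `x, y` values with sum of squares at most one.
  have hdual : ∀ x y : X, ‖x‖ = 1 → ‖y‖ = 1 → QuasiOrthogonal y x →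
      ∀ p : StrongDual ℝ X, ‖p‖ = 1 → p x ^ 2 + p y ^ 2 ≤ 1 := by
    intro x y hx hy hyx p hp
    have h1 := hle x y hx hy hyx (p x) (p y)
    have h2 : p (p x • x + p y • y) = p x ^ 2 + p y ^ 2 := by
      simp only [map_add, map_smul, smul_eq_mul]; ring
    have h3 := (le_abs_self _).trans (p.le_opNorm (p x • x + p y • y))
    rw [h2, hp, one_mul] at h3
    by_contra! h4
    nlinarith [norm_nonneg (p x • x + p y • y)]
  have hli := hyx.linearIndependent hx hy
  refine norm_sq_eq_of_unit (fun a b hz => ?_) hli a b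
  obtain ⟨c, d, hw, hwz⟩ := exists_quasiOrthogonal_combination hli hz rfl
  have hz1 := hle x y hx hy hyx a b
  have hw1 := hle x y hx hy hyx c d
  rw [hz] at hz1
  rw [hw] at hw1
  obtain ⟨q, hq, hqy⟩ := exists_dual_vector ℝ y (by rw [hy]; norm_num)
  have hqy1 : q y = 1 := by rw [hqy, hy]; rfl
  have hqx : q x = 0 := by
    have := hdual x y hx hy hyx q hq
    rw [hqy1] at this
    nlinarith [sq_nonneg (q x)]
  obtain ⟨p, hp, hpx, hpy⟩ := hyx
  have k1 := hdual _ _ hz hw hwz p hp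
  have k2 := hdual _ _ hz hw hwz q hq
  simp only [map_add, map_smul, smul_eq_mul, hpx, hpy, hqx, hqy1, hx, mul_one, mul_zero, add_zero,
    zero_add] at k1 k2
  linarith

theorem isHilbertSpace_of_supportingConvexity_eq [CompleteSpace X]
    (h : ∀ r ∈ Set.Icc (0 : ℝ) 1, supportingConvexity X r = 1 - Real.sqrt (1 - r ^ 2)) :
    IsHilbertSpace X := by
  refine isHilbertSpace_of_norm_sq_eq fun x y hx hy hyx =>
    norm_sq_eq_of_ball_subset_ellipse (fun x y hx hy hyx a b hab => ?_) hx hy hyx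
  have hdepth : ∀ y' : X, ‖y'‖ = 1 → QuasiOrthogonal y' x → ∀ a b : ℝ, 0 ≤ a → 0 ≤ b → b ≤ 1 →
      ‖a • x + b • y'‖ ≤ 1 → a ^ 2 + b ^ 2 ≤ 1 := by
    intro y' hy' hyx' a b ha hb hb1 hab
    have ha1 : a ≤ 1 := by
      obtain ⟨p, hp, hpx, hpy⟩ := hyx'
      have := (le_abs_self _).trans (p.le_opNorm (a • x + b • y'))
      simp only [map_add, map_smul, hpx, hpy, hp, hx, smul_eq_mul, mul_one, mul_zero, add_zero,
        one_mul] at this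
      exact this.trans hab
    have h1 := supportingConvexity_le_supportingDepth hx hy' hyx' hb hb1
    rw [h b ⟨hb, hb1⟩] at h1
    have h2 := h1.trans (supportingDepth_le_of_norm_le hx hy' hyx' hb hb1 ha1 hab)
    have h3 : a ≤ Real.sqrt (1 - b ^ 2) := by linarith
    have h4 := (Real.le_sqrt ha (by nlinarith)).1 h3
    linarith
  have hquad : ∀ y' : X, ‖y'‖ = 1 → QuasiOrthogonal y' x → ∀ a b : ℝ, 0 ≤ a → 0 ≤ b →
      ‖a • x + b • y'‖ ≤ 1 → a ^ 2 + b ^ 2 ≤ 1 := by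
    intro y' hy' hyx' a b ha hb hab
    rcases le_or_gt b 1 with hb1 | hb1
    · exact hdepth y' hy' hyx' a b ha hb hb1 hab
    -- If `b > 1`, moving from the given point towards `x` reaches height exactly 1 with a positive
    -- `x`-coordinate, contradicting `hdepth`.
    exfalso
    have hb0 : 0 < b := by linarith
    have hbi : b⁻¹ < 1 := inv_lt_one_of_one_lt₀ hb1
    have hbi0 : 0 < b⁻¹ := by positivity
    have hpos : 0 < a / b + (1 - b⁻¹) := by
      have : 0 ≤ a / b := by positivity
      linarith
    have := hdepth y' hy' hyx' (a / b + (1 - b⁻¹)) 1 hpos.le zero_le_one le_rfl (by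
      have hvec : (a / b + (1 - b⁻¹)) • x + (1 : ℝ) • y' =
          b⁻¹ • (a • x + b • y') + (1 - b⁻¹) • x := by
        have : (1 : ℝ) • y' = b⁻¹ • b • y' := by rw [inv_smul_smul₀ hb0.ne', one_smul]
        rw [this, div_eq_mul_inv]
        module
      rw [hvec]
      refine (norm_add_le _ _).trans ?_
      rw [norm_smul, norm_smul, hx, Real.norm_of_nonneg hbi0.le,
        Real.norm_of_nonneg (sub_nonneg.2 hbi.le)]
      nlinarith)
    nlinarith [sq_pos_of_pos hpos]
  rw [← sq_abs a, ← sq_abs b]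
  have hny : ‖-y‖ = 1 := by rwa [norm_neg]
  rcases le_total 0 a with ha | ha <;> rcases le_total 0 b with hb | hb
  · exact hquad y hy hyx _ _ (abs_nonneg _) (abs_nonneg _)
      (by rwa [abs_of_nonneg ha, abs_of_nonneg hb])
  · exact hquad (-y) hny hyx.neg_left _ _ (abs_nonneg _) (abs_nonneg _)
      (by rwa [abs_of_nonneg ha, abs_of_nonpos hb, neg_smul_neg])
  · exact hquad (-y) hny hyx.neg_left _ _ (abs_nonneg _) (abs_nonneg _) (by
      have hvec : (-a) • x + b • -y = -(a • x + b • y) := by module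
      rwa [abs_of_nonpos ha, abs_of_nonneg hb, hvec, norm_neg])
  · exact hquad y hy hyx _ _ (abs_nonneg _) (abs_nonneg _) (by
      have hvec : (-a) • x + (-b) • y = -(a • x + b • y) := by module
      rwa [abs_of_nonpos ha, abs_of_nonpos hb, hvec, norm_neg])

theorem isHilbertSpace_of_supportingSmoothness_eq [CompleteSpace X]
    (h : ∀ r ∈ Set.Icc (0 : ℝ) 1, supportingSmoothness X r = 1 - Real.sqrt (1 - r ^ 2)) :
    IsHilbertSpace X := by
  refine isHilbertSpace_of_norm_sq_eq fun x y hx hy hyx =>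
    norm_sq_eq_of_ellipse_subset_ball (fun x y hx hy hyx a b hab => ?_) hx hy hyx
  have hquad : ∀ y' : X, ‖y'‖ = 1 → QuasiOrthogonal y' x → ∀ a b : ℝ, 0 ≤ a → 0 ≤ b →
      a ^ 2 + b ^ 2 = 1 → ‖a • x + b • y'‖ ≤ 1 := by
    intro y' hy' hyx' a b ha hb hab
    have hb1 : b ≤ 1 := by nlinarith
    have h1 := supportingDepth_le_supportingSmoothness hx hy' hyx' hb le_rfl hb1
    have h2 : Real.sqrt (1 - b ^ 2) = a := by
      rw [← hab, add_sub_cancel_right, Real.sqrt_sq ha]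
    rw [h b ⟨hb, hb1⟩, h2] at h1
    rcases hb1.eq_or_lt with rfl | hb1
    · have ha0 : a = 0 := by nlinarith
      simp [ha0, hy']
    by_contra! h3
    have hz := norm_supportingDepth hx hy' hyx' hb hb1.le
    -- Depth equal to `1 - a` puts the point on the sphere; smaller depth puts it in the open ball.
    rcases h1.eq_or_lt with h4 | h4
    · rw [h4] at hz
      rw [sub_sub_cancel] at hz
      linarith
    · linarith [norm_lt_one_of_supportingDepth_lt hx hy' hyx' hb hb1 ha h4]
  have hab' : |a| ^ 2 + |b| ^ 2 = 1 := by rwa [sq_abs, sq_abs]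
  have hny : ‖-y‖ = 1 := by rwa [norm_neg]
  have h1 := hquad y hy hyx _ _ (abs_nonneg a) (abs_nonneg b) hab'
  have h2 := hquad (-y) hny hyx.neg_left _ _ (abs_nonneg a) (abs_nonneg b) hab'
  rcases le_total 0 a with ha | ha <;> rcases le_total 0 b with hb | hb
  · rwa [abs_of_nonneg ha, abs_of_nonneg hb] at h1
  · rwa [abs_of_nonneg ha, abs_of_nonpos hb, neg_smul_neg] at h2
  · have hvec : (-a) • x + b • -y = -(a • x + b • y) := by module
    rwa [abs_of_nonpos ha, abs_of_nonneg hb, hvec, norm_neg] at h2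
  · have hvec : (-a) • x + (-b) • y = -(a • x + b • y) := by module
    rwa [abs_of_nonpos ha, abs_of_nonpos hb, hvec, norm_neg] at h1

end Rigidity

theorem mainTheorem5 {X : Type*} [NormedAddCommGroup X] [NormedSpace ℝ X] [CompleteSpace X]
    (hX : 2 ≤ Module.rank ℝ X)
    {H : Type*} [NormedAddCommGroup H] [InnerProductSpace ℝ H] [CompleteSpace H]
    (hH : 2 ≤ Module.rank ℝ H) :
    (∀ r ∈ Set.Icc (0 : ℝ) 1,
      supportingConvexity X r ≤ supportingConvexity H r ∧
      supportingConvexity H r = 1 - Real.sqrt (1 - r ^ 2) ∧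
      1 - Real.sqrt (1 - r ^ 2) = supportingSmoothness H r ∧
      supportingSmoothness H r ≤ supportingSmoothness X r) ∧
    ((∀ r ∈ Set.Icc (0 : ℝ) 1, supportingConvexity X r = 1 - Real.sqrt (1 - r ^ 2)) →
      IsHilbertSpace X) ∧
    ((∀ r ∈ Set.Icc (0 : ℝ) 1, supportingSmoothness X r = 1 - Real.sqrt (1 - r ^ 2)) →
      IsHilbertSpace X) := by
  refine ⟨fun r hr => ?_, isHilbertSpace_of_supportingConvexity_eq,
    isHilbertSpace_of_supportingSmoothness_eq⟩
  have h1 := supportingConvexity_eq_of_innerProductSpace hH hr.1 hr.2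
  have h2 := supportingSmoothness_eq_of_innerProductSpace hH hr.1 hr.2
  refine ⟨?_, h1, h2.symm, ?_⟩
  · rw [h1]
    exact supportingConvexity_le_one_sub_sqrt hX hr.1 hr.2
  · rw [h2]
    exact one_sub_sqrt_le_supportingSmoothness hX hr.1 hr.2
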